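/- An \emph{mm-space} is a triple $X=(X,d_X,\mu_X)$ where $(X,d_X)$ is a complete separable metric space and $\mu_X$ is a Borel probability measure on $X$. Two mm-spaces $X,Y$ are \emph{mm-isomorphic} if there is a surjective isometry $F:\operatorname{supp}\mu_X\to\operatorname{supp}\mu_Y$ with $F_*\mu_X=\mu_Y$; let $\mathcal X$ be the set of mm-isomorphism classes of mm-spaces. The \emph{box distance} $\Box(X,Y)$ is the infimum of those $\varepsilon\ge 0$ for which there exist Borel maps $\varphi:[0,1)\to X$ and $\psi:[0,1)\to Y$ pushing Lebesgue measure forward to $\mu_X$ and $\mu_Y$ respectively, and a Borel set $I_0\subset[0,1)$ of Lebesgue measure at least $1-\varepsilon$, such that $|d_X(\varphi(s),\varphi(t))-d_Y(\psi(s),\psi(t))|\le\varepsilon$ for all $s,t\in I_0$. We write $Y\prec X$ if there is a $1$-Lipschitz map $f:X\to Y$ with $f_*\mu_X=\mu_Y$. For $\varepsilon>0$ we write $Y\prec_\varepsilon X$ if there are a Borel set $\tilde X\subset X$ and a Borel map $f:X\to Y$ such that $\mu_X(\tilde X)\ge 1-\varepsilon$, $d_Y(f(x),f(x'))\le d_X(x,x')+\varepsilon$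 for all $x,x'\in\tilde X$, and $d_P(f_*\mu_X,\mu_Y)\le\varepsilon$, where $d_P$ is the Prohorov distance. For elements of $\mathcal X$, the relations $\prec$ and $\prec_\varepsilon$ are understood to hold if they hold for some representatives. A \emph{pyramid} is a non-empty closed subset $\mathcal P$ of $(\mathcal X,\Box)$ such that (1) if $X\in\mathcal P$, $Y\in\mathcal X$ and $Y\prec X$, then $Y\in\mathcal P$; and (2) if $X,Y\in\mathcal P$, then there is $Z\in\mathcal P$ with $X\prec Z$ and $Y\prec Z$. For pyramids $\mathcal P,\mathcal Q$ and $\varepsilon>0$ we write $\mathcal Q\prec_\varepsilon\mathcal P$ if for every $Y\in\mathcal Q$ there is $X\in\mathcal P$ with $Y\prec_\varepsilon X$. \textbf{Corollary.} If pyramids $\mathcal P$ and $\mathcal Q$ satisfy $\mathcal P\prec_\varepsilon\mathcal Q$ and $\mathcal Q\prec_\varepsilon\mathcal P$ for every $\varepsilon>0$, then $\mathcal P=\mathcal Q$. -/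

import Mathlib

open MeasureTheory

universe u

/-- A metric measure space (mm-space): a complete separable metric space with a Borel
probability measure. -/
structure MMSpace : Type (u + 1) where
  carrier : Type u
  [metric : MetricSpace carrier]
  [meas : MeasurableSpace carrier]
  [borel : BorelSpace carrier]
  [complete : CompleteSpace carrier]
  [separable : TopologicalSpace.SeparableSpace carrier]
  μ : Measure carrier
  [prob : IsProbabilityMeasure μ]

namespace MMSpace

instance : CoeSort MMSpace.{u} (Type u) := ⟨MMSpace.carrier⟩

attribute [instance] MMSpace.metric MMSpace.meas MMSpace.borel MMSpace.complete
  MMSpace.separable MMSpace.prob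

/-- The support of the measure of an mm-space. -/
def supp (X : MMSpace.{u}) : Set X := X.μ.support

/-- The measure of an mm-space, seen as a measure on its support. -/
noncomputable def suppMeasure (X : MMSpace.{u}) : Measure X.supp :=
  X.μ.comap Subtype.val

/-- `X` and `Y` are mm-isomorphic: there is a measure-preserving bijective isometry between the
supports of their measures. -/
def Iso (X Y : MMSpace.{u}) : Prop :=
  ∃ F : X.supp ≃ᵢ Y.supp, X.suppMeasure.map F = Y.suppMeasure

theorem Iso.refl (X : MMSpace.{u}) : Iso X X :=
  ⟨IsometryEquiv.refl _, by
    change X.suppMeasure.map id = _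
    exact Measure.map_id⟩

theorem Iso.symm {X Y : MMSpace.{u}} (h : Iso X Y) : Iso Y X := by
  obtain ⟨F, hF⟩ := h
  refine ⟨F.symm, ?_⟩
  rw [← hF, Measure.map_map F.symm.continuous.measurable F.continuous.measurable]
  have : (F.symm : Y.supp → X.supp) ∘ F = id := by ext x; simp
  rw [this, Measure.map_id]

theorem Iso.trans {X Y Z : MMSpace.{u}} (h : Iso X Y) (h' : Iso Y Z) : Iso X Z := by
  obtain ⟨F, hF⟩ := h
  obtain ⟨G, hG⟩ := h'
  refine ⟨F.trans G, ?_⟩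
  rw [← hG, ← hF, Measure.map_map G.continuous.measurable F.continuous.measurable]
  rfl

instance setoid : Setoid MMSpace.{u} where
  r := Iso
  iseqv := ⟨Iso.refl, Iso.symm, Iso.trans⟩

/-- The Lipschitz order `Y ≺ X`: there is a `1`-Lipschitz map `f : X → Y` with `f_* μ_X = μ_Y`. -/
def Dom (Y X : MMSpace.{u}) : Prop :=
  ∃ f : X → Y, LipschitzWith 1 f ∧ X.μ.map f = Y.μ

/-- The relation `Y ≺_ε X`; the set `A` is the non-exceptional domain, and
`levyProkhorovDist` is the Prohorov distance. -/
def DomApprox (ε : ℝ) (Y X : MMSpace.{u}) : Prop :=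
  ∃ (A : Set X) (f : X → Y), MeasurableSet A ∧ Measurable f ∧
    ENNReal.ofReal (1 - ε) ≤ X.μ A ∧
    (∀ x ∈ A, ∀ x' ∈ A, dist (f x) (f x') ≤ dist x x' + ε) ∧
    levyProkhorovDist (X.μ.map f) Y.μ ≤ ε

/-- Lebesgue measure on `[0,1)`. -/
noncomputable def lebIco : Measure (Set.Ico (0 : ℝ) 1) :=
  (volume : Measure ℝ).comap Subtype.val

/-- A parameter of `X`: a Borel map `φ : [0,1) → X` that pushes Lebesgue measure to `μ_X`. -/
def IsParameter (X : MMSpace.{u}) (φ : Set.Ico (0 : ℝ) 1 → X) : Prop :=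
  Measurable φ ∧ lebIco.map φ = X.μ

/-- The box distance between two pseudo-metrics on `[0,1)`: the infimum of the `ε ≥ 0` for which
there is a Borel set of Lebesgue measure at least `1 - ε` on which they differ by at most `ε`. -/
noncomputable def boxPseudo (ρ₁ ρ₂ : Set.Ico (0 : ℝ) 1 → Set.Ico (0 : ℝ) 1 → ℝ) : ENNReal :=
  ⨅ (ε : ℝ) (_ : 0 ≤ ε ∧ ∃ I₀ : Set (Set.Ico (0 : ℝ) 1), MeasurableSet I₀ ∧
      (∀ s ∈ I₀, ∀ t ∈ I₀, |ρ₁ s t - ρ₂ s t| ≤ ε) ∧ ENNReal.ofReal (1 - ε) ≤ lebIco I₀),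
    ENNReal.ofReal ε

/-- The box distance between mm-spaces: the infimum over all parameters of the box distance
between the pulled-back pseudo-metrics. -/
noncomputable def box (X Y : MMSpace.{u}) : ENNReal :=
  ⨅ (φ : Set.Ico (0 : ℝ) 1 → X) (_ : X.IsParameter φ)
    (ψ : Set.Ico (0 : ℝ) 1 → Y) (_ : Y.IsParameter ψ),
    boxPseudo (fun s t => dist (φ s) (φ t)) (fun s t => dist (ψ s) (ψ t))

theorem measurableSet_supp (X : MMSpace.{u}) : MeasurableSet X.supp :=
  Measure.isClosed_support.measurableSet

theorem supp_ae (X : MMSpace.{u}) : X.supp ∈ ae X.μ := by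
  have : SecondCountableTopology X := UniformSpace.secondCountable_of_separable X
  exact Measure.support_mem_ae

theorem map_suppMeasure (X : MMSpace.{u}) : X.suppMeasure.map Subtype.val = X.μ := by
  rw [suppMeasure, map_comap_subtype_coe X.measurableSet_supp]
  exact Measure.restrict_eq_self_of_ae_mem X.supp_ae

/-- Parameters can be transported along mm-isomorphisms, up to null sets. -/
theorem IsParameter.transport {X Y : MMSpace.{u}} (h : Iso X Y) {φ : Set.Ico (0 : ℝ) 1 → X}
    (hφ : X.IsParameter φ) :
    ∃ ψ : Set.Ico (0 : ℝ) 1 → Y, Y.IsParameter ψ ∧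
      ∃ N : Set (Set.Ico (0 : ℝ) 1), MeasurableSet N ∧ lebIco Nᶜ = 0 ∧
        ∀ s ∈ N, ∀ t ∈ N, dist (ψ s) (ψ t) = dist (φ s) (φ t) := by
  classical
  obtain ⟨F, hF⟩ := h
  have : Nonempty Y := nonempty_of_isProbabilityMeasure Y.μ
  let y₀ : Y := Classical.arbitrary Y
  let G : X → Y := fun x => if hx : x ∈ X.supp then (F ⟨x, hx⟩ : Y) else y₀
  have hGF : G ∘ (Subtype.val : X.supp → X) = Subtype.val ∘ F := by
    ext x
    simp [G]
  have hG : Measurable G := by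
    exact Measurable.dite (f := fun x : X.supp => (F x : Y)) (g := fun _ => y₀)
      (measurable_subtype_coe.comp F.continuous.measurable) measurable_const
      X.measurableSet_supp
  have hGμ : X.μ.map G = Y.μ := by
    rw [← X.map_suppMeasure, Measure.map_map hG measurable_subtype_coe, hGF,
      ← Measure.map_map measurable_subtype_coe F.continuous.measurable, hF, Y.map_suppMeasure]
  refine ⟨G ∘ φ, ⟨hG.comp hφ.1, ?_⟩, φ ⁻¹' X.supp, hφ.1 X.measurableSet_supp, ?_, ?_⟩
  · rw [← Measure.map_map hG hφ.1, hφ.2, hGμ]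
  · rw [← Set.preimage_compl, ← Measure.map_apply hφ.1 X.measurableSet_supp.compl, hφ.2]
    exact mem_ae_iff.mp X.supp_ae
  · intro s hs t ht
    have hs' : φ s ∈ X.supp := hs
    have ht' : φ t ∈ X.supp := ht
    simp only [Function.comp_apply, G, dif_pos hs', dif_pos ht']
    exact F.isometry.dist_eq ⟨φ s, hs'⟩ ⟨φ t, ht'⟩

theorem box_le_of_iso {X X' Y Y' : MMSpace.{u}} (hX : Iso X X') (hY : Iso Y Y') :
    box X' Y' ≤ box X Y := by
  refine le_iInf₂ fun φ hφ => le_iInf₂ fun ψ hψ => le_iInf₂ fun ε hε => ?_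
  obtain ⟨hε, I₀, hI₀, hd, hm⟩ := hε
  obtain ⟨φ', hφ', N, hN, hN0, hNd⟩ := hφ.transport hX
  obtain ⟨ψ', hψ', M, hM, hM0, hMd⟩ := hψ.transport hY
  refine (iInf₂_le φ' hφ').trans <| (iInf₂_le ψ' hψ').trans <| iInf₂_le ε ⟨hε, I₀ ∩ (N ∩ M),
    hI₀.inter (hN.inter hM), ?_, ?_⟩
  · intro s hs t ht
    simp only [hNd s hs.2.1 t ht.2.1, hMd s hs.2.2 t ht.2.2]
    exact hd s hs.1 t ht.1
  · have : lebIco (I₀ ∩ (N ∩ M)) = lebIco I₀ := by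
      refine measure_inter_conull ?_
      rw [Set.compl_inter]
      exact measure_union_null hN0 hM0
    rw [this]
    exact hm

end MMSpace

/-- The set `𝒳` of mm-isomorphism classes of mm-spaces. -/
def MMClass : Type (u + 1) := Quotient MMSpace.setoid.{u}

namespace MMClass

/-- The class of an mm-space. -/
def mk (X : MMSpace.{u}) : MMClass.{u} := Quotient.mk _ X

/-- The box distance on `𝒳`. -/
noncomputable def box : MMClass.{u} → MMClass.{u} → ENNReal :=
  Quotient.lift₂ MMSpace.box fun _ _ _ _ hX hY =>
    le_antisymm (MMSpace.box_le_of_iso hX.symm hY.symm) (MMSpace.box_le_of_iso hX hY)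

/-- The Lipschitz order `y ≺ x` on `𝒳`: it holds for some representatives. (A dominating map
restricts to the supports, so full-support representatives can always be used.) -/
def Dom (y x : MMClass.{u}) : Prop :=
  ∃ Y X : MMSpace.{u}, mk Y = y ∧ mk X = x ∧ Y.Dom X

/-- The relation `y ≺_ε x` on `𝒳`: it holds for some representatives. -/
def DomApprox (ε : ℝ) (y x : MMClass.{u}) : Prop :=
  ∃ Y X : MMSpace.{u}, mk Y = y ∧ mk X = x ∧ Y.DomApprox ε X

/-- Closedness in `(𝒳, □)`: every adherent point of the set belongs to it. -/
def IsBoxClosed (P : Set MMClass.{u}) : Prop :=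
  ∀ x : MMClass.{u}, (∀ ε : ENNReal, 0 < ε → ∃ y ∈ P, box x y < ε) → x ∈ P

/-- A pyramid: a non-empty `□`-closed set of classes, closed downwards and directed upwards
for the Lipschitz order. -/
structure IsPyramid (P : Set MMClass.{u}) : Prop where
  nonempty : P.Nonempty
  closed : IsBoxClosed P
  lower : ∀ x ∈ P, ∀ y : MMClass.{u}, Dom y x → y ∈ P
  directed : ∀ x ∈ P, ∀ y ∈ P, ∃ z ∈ P, Dom x z ∧ Dom y z

/-- The relation `Q ≺_ε P` between sets of classes (used for pyramids): every `y ∈ Q` admits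
`x ∈ P` with `y ≺_ε x`. -/
def PyramidApprox (ε : ℝ) (Q P : Set MMClass.{u}) : Prop :=
  ∀ y ∈ Q, ∃ x ∈ P, DomApprox ε y x

end MMClass

/-! By symmetry it suffices that a `□`-closed, downward closed set `Q` contains every class `y` with
`y ≺_ε x` for some `x ∈ Q`, for each `ε > 0` (`mem_of_forall_domApprox`). The map `f : X → Y` behind
`Y ≺_ε X` is Lipschitz only up to an error, so it gives no domination. After composition with a
`1`-Lipschitz `F : Y → ℓ^∞_N` it can be corrected, coordinate by coordinate, to a `1`-Lipschitz map
on all of `X`. Hence `Q` contains laws on `ℓ^∞_N` that are Prohorov-close to `F_* μ_Y`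
(`exists_lipschitz_le_thickening`). Prohorov closeness to a fixed measure forces box closeness
(`exists_box_le_of_le_thickening`), so `F_* μ_Y` lies in `Q`. Since `Y` is a box limit of such
images (`exists_box_lipschitzImage_le`), so does `Y`. -/

open scoped ENNReal Topology
open Set Metric Filter ProbabilityTheory

/-! ### Couplings that retain mass on prescribed sets -/

/-- Two finite probability vectors admit a joint distribution whose diagonal dominates their
minimum. -/
theorem exists_joint_vector {ι : Type*} [Fintype ι] (p q : ι → ℝ≥0∞)
    (hp : ∑ i, p i = 1) (hq : ∑ i, q i = 1) :
    ∃ a : ι → ι → ℝ≥0∞, (∀ i, ∑ j, a i j = p i) ∧ (∀ j, ∑ i, a i j = q j) ∧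
      ∀ i, min (p i) (q i) ≤ a i i := by
  classical
  -- The common part `m` goes on the diagonal. The excesses `v` and `w` have equal total mass `r`
  -- and are coupled by their normalised product.
  let m : ι → ℝ≥0∞ := fun i => min (p i) (q i)
  let v : ι → ℝ≥0∞ := fun i => p i - m i
  let w : ι → ℝ≥0∞ := fun i => q i - m i
  have hv : ∀ i, m i + v i = p i := fun i => add_tsub_cancel_of_le (min_le_left _ _)
  have hw : ∀ i, m i + w i = q i := fun i => add_tsub_cancel_of_le (min_le_right _ _)
  have hm : ∑ i, m i ≠ ∞ :=
    ne_top_of_le_ne_top ENNReal.one_ne_top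
      (hp ▸ Finset.sum_le_sum fun i _ => min_le_left (p i) (q i))
  have hvw : ∑ i, v i = ∑ i, w i := by
    refine (ENNReal.add_right_inj hm).1 ?_
    rw [← Finset.sum_add_distrib, ← Finset.sum_add_distrib]
    simp only [hv, hw, hp, hq]
  have hvtop : ∑ i, v i ≠ ∞ :=
    ne_top_of_le_ne_top ENNReal.one_ne_top (hp ▸ Finset.sum_le_sum fun i _ => tsub_le_self)
  set r : ℝ≥0∞ := ∑ i, v i with hr
  -- If `r = 0` then `r⁻¹ = ∞`, but `x = 0` and `0 * ∞ = 0`.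
  have key : ∀ x : ℝ≥0∞, x ≤ r → x * r * r⁻¹ = x := by
    intro x hx
    rcases eq_or_ne r 0 with h0 | h0
    · simp [nonpos_iff_eq_zero.1 (h0 ▸ hx)]
    · rw [mul_assoc, ENNReal.mul_inv_cancel h0 hvtop, mul_one]
  refine ⟨fun i j => (if i = j then m i else 0) + v i * w j * r⁻¹, fun i => ?_, fun j => ?_,
    fun i => ?_⟩
  · rw [Finset.sum_add_distrib, Finset.sum_ite_eq, if_pos (Finset.mem_univ _),
      ← Finset.sum_mul, ← Finset.mul_sum, ← hvw,
      key _ (Finset.single_le_sum (fun _ _ => zero_le) (Finset.mem_univ i)), hv]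
  · rw [Finset.sum_add_distrib, Finset.sum_ite_eq', if_pos (Finset.mem_univ _),
      ← Finset.sum_mul, ← Finset.sum_mul, mul_comm _ (w j),
      key _ (hvw ▸ Finset.single_le_sum (fun _ _ => zero_le) (Finset.mem_univ j)), hw]
  · simp [m]

/-- Two probability measures on a space with a finite measurable labelling admit a coupling that
keeps as much mass as possible inside each label. -/
theorem exists_coupling_of_label {Ω ι : Type*} [MeasurableSpace Ω] [Fintype ι]
    [MeasurableSpace ι] [MeasurableSingletonClass ι] {l : Ω → ι} (hl : Measurable l)
    (ν ν' : Measure Ω) [IsProbabilityMeasure ν] [IsProbabilityMeasure ν'] :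
    ∃ π : Measure (Ω × Ω), π.map Prod.fst = ν ∧ π.map Prod.snd = ν' ∧
      ∀ i, min (ν (l ⁻¹' {i})) (ν' (l ⁻¹' {i})) ≤ π ((l ⁻¹' {i}) ×ˢ (l ⁻¹' {i})) := by
  classical
  have hsum : ∀ (ρ : Measure Ω) [IsProbabilityMeasure ρ], ∑ i, ρ (l ⁻¹' {i}) = 1 := by
    intro ρ _
    have := congrArg (fun σ : Measure Ω => σ univ) (sum_meas_smul_cond_fiber hl ρ)
    simp only [Measure.coe_finsetSum, Finset.sum_apply, Measure.smul_apply, smul_eq_mul,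
      measure_univ] at this
    rw [← this]
    refine Finset.sum_congr rfl fun i _ => ?_
    rcases eq_or_ne (ρ (l ⁻¹' {i})) 0 with h0 | h0
    · simp [h0]
    · have := cond_isProbabilityMeasure h0
      simp
  obtain ⟨a, ha₁, ha₂, ha₃⟩ := exists_joint_vector _ _ (hsum ν) (hsum ν')
  -- Conditioning on a null set gives the zero measure, not a probability; `a` vanishes at exactly
  -- such labels, so no mass is lost.
  have hz₁ : ∀ i j, ν (l ⁻¹' {i}) = 0 → a i j = 0 := fun i j h => by
    have := ha₁ i
    rw [h, Finset.sum_eq_zero_iff] at this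
    exact this j (Finset.mem_univ _)
  have hz₂ : ∀ i j, ν' (l ⁻¹' {j}) = 0 → a i j = 0 := fun i j h => by
    have := ha₂ j
    rw [h, Finset.sum_eq_zero_iff] at this
    exact this i (Finset.mem_univ _)
  refine ⟨∑ i, ∑ j, a i j • (ν[|l ⁻¹' {i}]).prod (ν'[|l ⁻¹' {j}]), ?_, ?_, fun i => ?_⟩
  · conv_rhs => rw [← sum_meas_smul_cond_fiber hl ν]
    simp only [Measure.map_finset_sum measurable_fst.aemeasurable]
    refine Finset.sum_congr rfl fun i _ => ?_
    rw [← ha₁ i, Finset.sum_smul]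
    refine Finset.sum_congr rfl fun j _ => ?_
    rw [Measure.map_smul, Measure.map_fst_prod]
    by_cases h0 : ν' (l ⁻¹' {j}) = 0
    · simp [hz₂ i j h0]
    · have := cond_isProbabilityMeasure h0
      simp
  · conv_rhs => rw [← sum_meas_smul_cond_fiber hl ν']
    rw [Finset.sum_comm]
    simp only [Measure.map_finset_sum measurable_snd.aemeasurable]
    refine Finset.sum_congr rfl fun j _ => ?_
    rw [← ha₂ j, Finset.sum_smul]
    refine Finset.sum_congr rfl fun i _ => ?_
    rw [Measure.map_smul, Measure.map_snd_prod]
    by_cases h0 : ν (l ⁻¹' {i}) = 0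
    · simp [hz₁ i j h0]
    · have := cond_isProbabilityMeasure h0
      simp
  · refine (ha₃ i).trans ?_
    simp only [Measure.coe_finsetSum, Finset.sum_apply, Measure.smul_apply, smul_eq_mul]
    have hle : a i i * (ν[|l ⁻¹' {i}]).prod (ν'[|l ⁻¹' {i}]) ((l ⁻¹' {i}) ×ˢ (l ⁻¹' {i})) ≤
        ∑ i', ∑ j', a i' j' *
          (ν[|l ⁻¹' {i'}]).prod (ν'[|l ⁻¹' {j'}]) ((l ⁻¹' {i}) ×ˢ (l ⁻¹' {i})) :=
      (Finset.single_le_sum (f := fun j' => a i j' *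
          (ν[|l ⁻¹' {i}]).prod (ν'[|l ⁻¹' {j'}]) ((l ⁻¹' {i}) ×ˢ (l ⁻¹' {i})))
        (fun _ _ => zero_le) (Finset.mem_univ i)).trans
      (Finset.single_le_sum (f := fun i' => ∑ j', a i' j' *
          (ν[|l ⁻¹' {i'}]).prod (ν'[|l ⁻¹' {j'}]) ((l ⁻¹' {i}) ×ˢ (l ⁻¹' {i})))
        (fun _ _ => zero_le) (Finset.mem_univ i))
    refine le_trans (le_of_eq ?_) hle
    by_cases h0 : ν (l ⁻¹' {i}) = 0
    · simp [hz₁ i i h0]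
    by_cases h0' : ν' (l ⁻¹' {i}) = 0
    · simp [hz₂ i i h0']
    rw [Measure.prod_prod, cond_apply_self h0 (measure_ne_top _ _),
      cond_apply_self h0' (measure_ne_top _ _), mul_one, mul_one]

/-- Two probability measures admit a coupling that keeps as much mass as possible inside each of
finitely many disjoint sets. -/
theorem exists_coupling_of_disjoint {Ω ι : Type*} [MeasurableSpace Ω] [Fintype ι]
    {B : ι → Set Ω} (hB : ∀ i, MeasurableSet (B i)) (hd : Pairwise (Function.onFun Disjoint B))
    (ν ν' : Measure Ω) [IsProbabilityMeasure ν] [IsProbabilityMeasure ν'] :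
    ∃ π : Measure (Ω × Ω), π.map Prod.fst = ν ∧ π.map Prod.snd = ν' ∧
      ∑ i, min (ν (B i)) (ν' (B i)) ≤ π (⋃ i, B i ×ˢ B i) := by
  classical
  -- A point is labelled by the set of indices whose `B i` contain it. By disjointness `B i` is the
  -- fibre over `{i}`, and points outside all `B i` get the empty label.
  let l : Ω → ι → Prop := fun x i => x ∈ B i
  have hl : Measurable l := measurable_pi_iff.2 fun i => measurable_mem.2 (hB i)
  have hpre : ∀ i, l ⁻¹' {fun j => j = i} ⊆ B i := by
    intro i x hx
    have : (x ∈ B i) = (i = i) := congrFun hx i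
    simpa using this
  have hsub : ∀ i, B i ⊆ l ⁻¹' {fun j => j = i} := by
    intro i x hx
    refine funext fun j => propext ⟨fun hj => ?_, fun hj => hj ▸ hx⟩
    by_contra hne
    exact Set.disjoint_left.1 (hd hne) hj hx
  obtain ⟨π, h₁, h₂, h₃⟩ := exists_coupling_of_label hl ν ν'
  refine ⟨π, h₁, h₂, ?_⟩
  rw [measure_iUnion, tsum_fintype]
  · refine Finset.sum_le_sum fun i _ => ?_
    have := h₃ fun j => j = i
    rwa [(hpre i).antisymm (hsub i)] at this
  · intro i j hij
    exact Set.disjoint_prod.2 (Or.inl (hd hij))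
  · exact fun i => (hB i).prod (hB i)

/-! ### From couplings and Prohorov closeness to the box distance -/

/-- Every probability measure on a standard Borel space is the image of Lebesgue measure on
`[0,1)`. -/
theorem exists_measurable_lebIco_map_eq {Ω : Type*} [MeasurableSpace Ω] [StandardBorelSpace Ω]
    (μ : Measure Ω) [IsProbabilityMeasure μ] :
    ∃ φ : Ico (0 : ℝ) 1 → Ω, Measurable φ ∧ MMSpace.lebIco.map φ = μ := by
  have : Nonempty Ω := nonempty_of_isProbabilityMeasure μ
  obtain ⟨f, hf, hfμ⟩ := μ.exists_measurable_map_eq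
  let inc : Ico (0 : ℝ) 1 → unitInterval := inclusion Ico_subset_Icc_self
  have hinc : Measurable inc := measurable_inclusion _
  refine ⟨f ∘ inc, hf.comp hinc, ?_⟩
  rw [← hfμ, ← Measure.map_map hf hinc]
  congr 1
  have hemb : MeasurableEmbedding (Subtype.val : Icc (0 : ℝ) 1 → ℝ) :=
    MeasurableEmbedding.subtype_coe measurableSet_Icc
  refine hemb.map_injective ?_
  rw [Measure.map_map hemb.measurable hinc]
  change Measure.map Subtype.val ((volume : Measure ℝ).comap Subtype.val) =
    Measure.map Subtype.val ((volume : Measure ℝ).comap Subtype.val)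
  rw [map_comap_subtype_coe measurableSet_Ico, map_comap_subtype_coe measurableSet_Icc]
  exact Measure.restrict_congr_set Ico_ae_eq_Icc

namespace MMSpace

/-- A coupling concentrated on pairs with nearly equal distances bounds the box distance. -/
theorem box_le_of_coupling {X Y : MMSpace.{u}} {π : Measure (X × Y)} (h₁ : π.map Prod.fst = X.μ)
    (h₂ : π.map Prod.snd = Y.μ) {ε : ℝ} (hε : 0 ≤ ε) {G : Set (X × Y)} (hG : MeasurableSet G)
    (hd : ∀ p ∈ G, ∀ q ∈ G, |dist p.1 q.1 - dist p.2 q.2| ≤ ε)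
    (hm : ENNReal.ofReal (1 - ε) ≤ π G) : box X Y ≤ ENNReal.ofReal ε := by
  have : SecondCountableTopology X := UniformSpace.secondCountable_of_separable X
  have : SecondCountableTopology Y := UniformSpace.secondCountable_of_separable Y
  have : IsProbabilityMeasure π := ⟨by
    rw [← preimage_univ (f := Prod.fst), ← Measure.map_apply measurable_fst .univ, h₁,
      measure_univ]⟩
  -- The coordinates of one parameter of `π` parametrise both spaces simultaneously.
  obtain ⟨φ, hφ, hφπ⟩ := exists_measurable_lebIco_map_eq π
  refine (iInf₂_le (fun s => (φ s).1) ⟨measurable_fst.comp hφ, ?_⟩).trans <|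
    (iInf₂_le (fun s => (φ s).2) ⟨measurable_snd.comp hφ, ?_⟩).trans <|
    iInf₂_le ε ⟨hε, φ ⁻¹' G, hφ hG, fun s hs t ht => hd _ hs _ ht, ?_⟩
  · rw [← h₁, ← hφπ, Measure.map_map measurable_fst hφ]
    rfl
  · rw [← h₂, ← hφπ, Measure.map_map measurable_snd hφ]
    rfl
  · rwa [← Measure.map_apply hφ hG, hφπ]

/-- Probability measures that are close in the (one-sided) Prohorov sense define mm-spaces that
are close in the box distance. -/
theorem exists_box_le_of_le_thickening {Z : Type u} [MetricSpace Z] [MeasurableSpace Z]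
    [BorelSpace Z] [CompleteSpace Z] [TopologicalSpace.SeparableSpace Z] (ν : Measure Z)
    [IsProbabilityMeasure ν] {δ : ℝ} (hδ : 0 < δ) :
    ∃ η > 0, ∀ (ν' : Measure Z) [IsProbabilityMeasure ν'],
      (∀ B, MeasurableSet B → ν B ≤ ν' (thickening η B) + ENNReal.ofReal η) →
      box { carrier := Z, μ := ν } { carrier := Z, μ := ν' } ≤ ENNReal.ofReal δ := by
  have : SecondCountableTopology Z := UniformSpace.secondCountable_of_separable Z
  obtain ⟨As, hAm, hAb, hAd, hAu, hAp⟩ :=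
    SeparableSpace.exists_measurable_partition_diam_le Z (show 0 < δ / 4 by positivity)
  have hpos : 0 < ENNReal.ofReal (δ / 4) := ENNReal.ofReal_pos.2 (by positivity)
  obtain ⟨N, hN⟩ : ∃ N : ℕ, 1 ≤ ∑ n ∈ Finset.range N, ν (As n) + ENNReal.ofReal (δ / 4) := by
    have h1 : HasSum (fun n => ν (As n)) 1 := by
      have := (ENNReal.summable (f := fun n => ν (As n))).hasSum
      rwa [← measure_iUnion hAp hAm, hAu, measure_univ] at this
    have h2 : Tendsto (fun N => ∑ n ∈ Finset.range N, ν (As n)) atTop (𝓝 1) :=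
      h1.tendsto_sum_nat
    have h3 : 1 - ENNReal.ofReal (δ / 4) < 1 :=
      ENNReal.sub_lt_self ENNReal.one_ne_top one_ne_zero hpos.ne'
    obtain ⟨N, hN⟩ := (h2.eventually (lt_mem_nhds h3)).exists
    exact ⟨N, tsub_le_iff_right.1 hN.le⟩
  -- Mass budget: `δ / 4` for the pieces beyond `N`, and `2 * e` for each of the `N` others (inner
  -- regularity, then `η ≤ e`), at most `3 * δ / 4` in all.
  set e : ℝ := δ / (4 * (N + 1)) with he
  have hepos : 0 < e := by positivity
  have hK : ∀ n, ∃ K ⊆ As n, IsCompact K ∧ ν (As n) < ν K + ENNReal.ofReal e := fun n =>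
    (hAm n).exists_isCompact_lt_add (measure_ne_top _ _) (ENNReal.ofReal_pos.2 hepos).ne'
  choose K hKA hKc hKν using hK
  -- The pieces `As n` may touch, whereas disjoint compact sets have disjoint thickenings.
  have hsep : ∀ i j : ℕ, ∃ r > 0, i ≠ j → Disjoint (thickening r (K i)) (thickening r (K j)) := by
    intro i j
    by_cases hij : i = j
    · exact ⟨1, one_pos, fun h => absurd hij h⟩
    · obtain ⟨r, hr, h⟩ := (((hAp hij).mono_left (hKA i)).mono_right (hKA j)).exists_thickenings
        (hKc i) (hKc j).isClosed
      exact ⟨r, hr, fun _ => h⟩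
  choose r hr hrd using hsep
  -- `η ≤ δ / 8` makes two points of one thickened piece at most `δ / 4 + 2 * η ≤ δ / 2` apart; a
  -- pair of pieces then costs at most `δ`.
  obtain ⟨η, hη, hηe, hηδ, hηr⟩ : ∃ η > 0, η ≤ e ∧ η ≤ δ / 8 ∧ ∀ i j : Fin N, η ≤ r i j := by
    have hev : ∀ c > (0 : ℝ), ∀ᶠ η in 𝓝[>] (0 : ℝ), η ≤ c := fun c hc =>
      mem_nhdsWithin_of_mem_nhds (Iic_mem_nhds hc)
    have hgt : ∀ᶠ η in 𝓝[>] (0 : ℝ), 0 < η := self_mem_nhdsWithin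
    obtain ⟨η, h⟩ := hgt.and
      ((hev e hepos).and ((hev (δ / 8) (by positivity)).and
      (eventually_all.2 fun i : Fin N => eventually_all.2 fun j : Fin N =>
        hev (r i j) (hr i j)))) |>.exists
    exact ⟨η, h.1, h.2.1, h.2.2.1, h.2.2.2⟩
  refine ⟨η, hη, fun ν' _ hν' => ?_⟩
  let B : Fin N → Set Z := fun n => thickening η (K n)
  have hBm : ∀ n, MeasurableSet (B n) := fun n => isOpen_thickening.measurableSet
  have hBd : Pairwise (Function.onFun Disjoint B) := fun i j hij =>
    ((hrd i j (Fin.val_injective.ne hij)).mono_left (thickening_mono (hηr i j) _)).mono_right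
      (thickening_mono (hηr i j) _)
  have hBdist : ∀ n, ∀ x ∈ B n, ∀ y ∈ B n, dist x y ≤ δ / 2 := by
    intro n x hx y hy
    obtain ⟨x', hx', hxx'⟩ := mem_thickening_iff.1 hx
    obtain ⟨y', hy', hyy'⟩ := mem_thickening_iff.1 hy
    have h1 := (dist_le_diam_of_mem (hAb n) (hKA n hx') (hKA n hy')).trans (hAd n)
    have h2 := dist_triangle4 x x' y' y
    rw [dist_comm y' y] at h2
    linarith
  obtain ⟨π, h₁, h₂, h₃⟩ := exists_coupling_of_disjoint hBm hBd ν ν'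
  refine box_le_of_coupling (X := { carrier := Z, μ := ν }) (Y := { carrier := Z, μ := ν' })
    (π := π) h₁ h₂ hδ.le (G := ⋃ i, B i ×ˢ B i)
    (MeasurableSet.iUnion fun i => (hBm i).prod (hBm i)) ?_ ?_
  · intro p hp q hq
    obtain ⟨i, hpi⟩ := mem_iUnion.1 hp
    obtain ⟨j, hqj⟩ := mem_iUnion.1 hq
    have h1 := hBdist i _ hpi.1 _ hpi.2
    have h2 := hBdist j _ hqj.1 _ hqj.2
    have h3 := dist_dist_dist_le p.1 q.1 p.2 q.2
    rw [Real.dist_eq] at h3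
    exact h3.trans (by linarith)
  · refine le_trans ?_ h₃
    have hmin : ∀ n : Fin N, ν (As n) ≤ min (ν (B n)) (ν' (B n)) + ENNReal.ofReal (2 * e) := by
      intro n
      have h1 : ν (K n) ≤ min (ν (B n)) (ν' (B n)) + ENNReal.ofReal e := by
        rw [← min_add_add_right]
        refine le_min ?_ ?_
        · exact (measure_mono (self_subset_thickening hη _)).trans le_self_add
        · exact (hν' _ (hKc n).measurableSet).trans (by gcongr)
      rw [two_mul, ENNReal.ofReal_add hepos.le hepos.le, ← add_assoc]
      exact (hKν n).le.trans (by gcongr)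
    rw [ENNReal.ofReal_sub _ hδ.le, ENNReal.ofReal_one, tsub_le_iff_right]
    calc (1 : ℝ≥0∞) ≤ ∑ n ∈ Finset.range N, ν (As n) + ENNReal.ofReal (δ / 4) := hN
      _ = ∑ n : Fin N, ν (As n) + ENNReal.ofReal (δ / 4) := by
        rw [Fin.sum_univ_eq_sum_range (fun n => ν (As n))]
      _ ≤ ∑ n : Fin N, (min (ν (B n)) (ν' (B n)) + ENNReal.ofReal (2 * e)) +
          ENNReal.ofReal (δ / 4) := by
        gcongr with n
        exact hmin n
      _ = ∑ n : Fin N, min (ν (B n)) (ν' (B n)) + ENNReal.ofReal (N * (2 * e) + δ / 4) := by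
        rw [Finset.sum_add_distrib, Finset.sum_const, Finset.card_univ, Fintype.card_fin,
          nsmul_eq_mul, add_assoc, ENNReal.ofReal_add (by positivity) (by positivity),
          ENNReal.ofReal_mul (Nat.cast_nonneg N), ENNReal.ofReal_natCast]
      _ ≤ _ := by
        gcongr
        have : (N : ℝ) * e ≤ δ / 4 := by
          rw [he, mul_div_assoc', div_le_div_iff₀ (by positivity) (by norm_num)]
          nlinarith
        linarith

end MMSpace

/-! ### Lipschitz images in finite-dimensional `ℓ^∞` spaces -/

/-- A real function that is `1`-Lipschitz up to an error `ε` on a set is within `ε` of a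
`1`-Lipschitz function there. -/
theorem exists_lipschitzWith_abs_sub_le {α : Type*} [PseudoMetricSpace α] {A : Set α}
    (hA : A.Nonempty) {g : α → ℝ} {ε : ℝ}
    (hg : ∀ x ∈ A, ∀ y ∈ A, |g x - g y| ≤ dist x y + ε) :
    ∃ G : α → ℝ, LipschitzWith 1 G ∧ ∀ x ∈ A, |G x - g x| ≤ ε := by
  have : Nonempty A := hA.to_subtype
  obtain ⟨a₀, ha₀⟩ := hA
  have hbdd : ∀ x : α, BddBelow (range fun a : A => g a + dist x a) := by
    intro x
    refine ⟨g a₀ - ε - dist x a₀, ?_⟩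
    rintro _ ⟨a, rfl⟩
    have h1 := (abs_le.1 (hg a a.2 a₀ ha₀)).1
    have h2 := dist_triangle (a : α) x a₀
    rw [dist_comm (a : α) x] at h2
    dsimp only
    linarith
  -- McShane's inf-convolution over `A`: the additive error in `g` lowers the infimum by at most
  -- `ε`.
  refine ⟨fun x => ⨅ a : A, g a + dist x a, LipschitzWith.of_le_add fun x y => ?_,
    fun x hx => abs_le.2 ⟨?_, ?_⟩⟩
  · rw [← sub_le_iff_le_add]
    refine le_ciInf fun a => ?_
    have h1 := ciInf_le (hbdd x) a
    have h2 := dist_triangle x y a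
    linarith
  · have : g x - ε ≤ ⨅ a : A, g a + dist x a := le_ciInf fun a => by
      have := (abs_le.1 (hg x hx a a.2)).2
      linarith
    linarith
  · have h1 : ⨅ a : A, g a + dist x a ≤ g x + dist x x := ciInf_le (hbdd x) ⟨x, hx⟩
    -- Comparing `x` with itself gives `0 ≤ ε`.
    have h2 := (abs_le.1 (hg x hx x hx)).2
    rw [dist_self] at h1 h2
    linarith

namespace MMSpace

/-- The image of an mm-space under a Lipschitz map to a finite-dimensional `ℓ^∞` space. -/
noncomputable def lipschitzImage (X : MMSpace.{u}) {ι : Type u} [Fintype ι] (F : X → ι → ℝ)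
    (hF : LipschitzWith 1 F) : MMSpace.{u} where
  carrier := ι → ℝ
  μ := X.μ.map F
  prob := Measure.isProbabilityMeasure_map hF.continuous.measurable.aemeasurable

theorem lipschitzImage_dom (X : MMSpace.{u}) {ι : Type u} [Fintype ι] (F : X → ι → ℝ)
    (hF : LipschitzWith 1 F) : (X.lipschitzImage F hF).Dom X :=
  ⟨F, hF, rfl⟩

/-- The laws of `1`-Lipschitz maps into a finite-dimensional `ℓ^∞` space only depend on the
isomorphism class. -/
theorem Iso.exists_lipschitz_map_eq {X Y : MMSpace.{u}} (h : Iso X Y) {ι : Type*} [Fintype ι]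
    {F : X → ι → ℝ} (hF : LipschitzWith 1 F) :
    ∃ G : Y → ι → ℝ, LipschitzWith 1 G ∧ Y.μ.map G = X.μ.map F := by
  classical
  obtain ⟨T, hT⟩ := h.symm
  -- The isometry exists only between supports. Its composite with `F` extends coordinatewise, and
  -- the law is unaffected since the support has full measure.
  let g : Y → ι → ℝ := fun y => if hy : y ∈ Y.supp then F (T ⟨y, hy⟩) else 0
  have hg : LipschitzOnWith 1 g Y.supp := by
    intro x hx y hy
    simp only [g, dif_pos hx, dif_pos hy]
    refine (hF _ _).trans_eq ?_
    have := T.isometry.edist_eq ⟨x, hx⟩ ⟨y, hy⟩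
    rw [Subtype.edist_eq, Subtype.edist_eq] at this
    rw [this]
  obtain ⟨G, hG, hgG⟩ := hg.extend_pi
  refine ⟨G, hG, ?_⟩
  rw [← X.map_suppMeasure, ← Y.map_suppMeasure, ← hT,
    Measure.map_map hG.continuous.measurable measurable_subtype_coe,
    Measure.map_map hF.continuous.measurable measurable_subtype_coe,
    Measure.map_map (hF.continuous.measurable.comp measurable_subtype_coe)
      T.continuous.measurable]
  congr 1
  ext1 y
  simp [← hgG y.2, g]

/-- If `Y ≺_ε X`, then every `1`-Lipschitz image of `Y` in a finite-dimensional `ℓ^∞` space is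
close to a `1`-Lipschitz image of `X`. -/
theorem DomApprox.exists_lipschitz_le_thickening {X Y : MMSpace.{u}} {ε : ℝ} (hε : 0 < ε)
    (hε1 : ε < 1) (h : Y.DomApprox ε X) {ι : Type*} [Fintype ι] {F : Y → ι → ℝ}
    (hF : LipschitzWith 1 F) :
    ∃ G : X → ι → ℝ, LipschitzWith 1 G ∧ ∀ B, MeasurableSet B →
      Y.μ.map F B ≤ X.μ.map G (thickening (4 * ε) B) + ENNReal.ofReal (4 * ε) := by
  obtain ⟨A, f, hA, hf, hAμ, hfA, hLP⟩ := h
  have hne : A.Nonempty := by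
    refine nonempty_of_measure_ne_zero (μ := X.μ) (ne_of_gt (lt_of_lt_of_le ?_ hAμ))
    exact ENNReal.ofReal_pos.2 (by linarith)
  have hFi : ∀ i, ∃ G : X → ℝ, LipschitzWith 1 G ∧ ∀ x ∈ A, |G x - F (f x) i| ≤ ε := fun i =>
    exists_lipschitzWith_abs_sub_le hne fun x hx y hy => by
      rw [← Real.dist_eq]
      refine ((dist_le_pi_dist (F (f x)) (F (f y)) i).trans ?_).trans (hfA x hx y hy)
      simpa using hF.dist_le_mul (f x) (f y)
  choose G hG hGF using hFi
  have hGL : LipschitzWith 1 fun x i => G i x := LipschitzWith.of_dist_le_mul fun x y => by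
    refine (dist_pi_le_iff (by positivity)).2 fun i => ?_
    exact (hG i).dist_le_mul x y
  refine ⟨fun x i => G i x, hGL, fun B hB => ?_⟩
  have : IsProbabilityMeasure (X.μ.map f) := Measure.isProbabilityMeasure_map hf.aemeasurable
  -- Doubling `ε` makes the Prohorov bound strict. The correction of `F ∘ f` and the exceptional set
  -- `Aᶜ` each add one more `ε`, so `4 * ε` suffices.
  have hlt : levyProkhorovEDist (X.μ.map f) Y.μ < ENNReal.ofReal (2 * ε) := by
    rw [ENNReal.lt_ofReal_iff_toReal_lt (levyProkhorovEDist_ne_top _ _)]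
    exact lt_of_le_of_lt hLP (by linarith)
  have hFm := hF.continuous.measurable
  have h1 := right_measure_le_of_levyProkhorovEDist_lt hlt (hFm hB)
  rw [ENNReal.toReal_ofReal (by positivity),
    Measure.map_apply hf isOpen_thickening.measurableSet] at h1
  rw [Measure.map_apply hFm hB,
    Measure.map_apply hGL.continuous.measurable isOpen_thickening.measurableSet]
  have hAc : X.μ Aᶜ ≤ ENNReal.ofReal ε := by
    rw [prob_compl_eq_one_sub hA, tsub_le_iff_right]
    calc (1 : ℝ≥0∞) = ENNReal.ofReal (ε + (1 - ε)) := by simp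
      _ = ENNReal.ofReal ε + ENNReal.ofReal (1 - ε) :=
        ENNReal.ofReal_add hε.le (by linarith)
      _ ≤ _ := by gcongr
  have hsub : f ⁻¹' thickening (2 * ε) (F ⁻¹' B) ⊆
      (fun x i => G i x) ⁻¹' thickening (4 * ε) B ∪ Aᶜ := by
    intro x hx
    by_cases hxA : x ∈ A
    · left
      obtain ⟨y, hy, hxy⟩ := mem_thickening_iff.1 hx
      refine mem_thickening_iff.2 ⟨F y, hy, ?_⟩
      have h2 : dist (fun i => G i x) (F (f x)) ≤ ε :=
        (dist_pi_le_iff hε.le).2 fun i => by rw [Real.dist_eq]; exact hGF i x hxA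
      have h3 : dist (F (f x)) (F y) ≤ dist (f x) y := by simpa using hF.dist_le_mul (f x) y
      have h4 := dist_triangle (fun i => G i x) (F (f x)) (F y)
      linarith
    · exact Or.inr hxA
  calc Y.μ (F ⁻¹' B) ≤ _ := h1
    _ ≤ X.μ ((fun x i => G i x) ⁻¹' thickening (4 * ε) B) + ENNReal.ofReal ε +
        ENNReal.ofReal (2 * ε) := by
      gcongr
      exact (measure_mono hsub).trans ((measure_union_le _ _).trans (by gcongr))
    _ ≤ _ := by
      rw [add_assoc, ← ENNReal.ofReal_add hε.le (by positivity)]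
      gcongr
      linarith

/-- Every mm-space is a box limit of its `1`-Lipschitz images in finite-dimensional `ℓ^∞`
spaces. -/
theorem exists_box_lipschitzImage_le (Y : MMSpace.{u}) {δ : ℝ} (hδ : 0 < δ) :
    ∃ (ι : Type u) (_ : Fintype ι) (F : Y → ι → ℝ) (hF : LipschitzWith 1 F),
      box Y (Y.lipschitzImage F hF) ≤ ENNReal.ofReal δ := by
  have : SecondCountableTopology Y := UniformSpace.secondCountable_of_separable Y
  obtain ⟨K, -, hKc, hK⟩ := MeasurableSet.univ.exists_isCompact_lt_add (μ := Y.μ)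
    (measure_ne_top _ _) (ENNReal.ofReal_pos.2 hδ).ne'
  obtain ⟨t, -, ht, htK⟩ := hKc.finite_cover_balls (show 0 < δ / 2 by positivity)
  have : Fintype t := ht.fintype
  -- Distances to a `δ / 2`-net of `K`: if `x ∈ K` is within `δ / 2` of `a`, then `dist y a - dist x
  -- a ≥ dist x y - 2 * dist x a > dist x y - δ`.
  let F : Y → t → ℝ := fun y a => dist y a
  have hF : LipschitzWith 1 F := LipschitzWith.of_dist_le_mul fun x y => by
    refine (dist_pi_le_iff (by positivity)).2 fun a => ?_
    simpa using (LipschitzWith.dist_left (a : Y)).dist_le_mul x y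
  have hFm := hF.continuous.measurable
  refine ⟨t, this, F, hF, ?_⟩
  have hgm : Measurable fun y => (y, F y) := measurable_id.prodMk hFm
  have hclosed : MeasurableSet {p : Y × (t → ℝ) | p.1 ∈ K ∧ p.2 = F p.1} :=
    (measurable_fst hKc.measurableSet).inter
      (measurableSet_eq_fun measurable_snd (hFm.comp measurable_fst))
  have h₁ : (Y.μ.map fun y => (y, F y)).map Prod.fst = Y.μ := by
    rw [Measure.map_map measurable_fst hgm]
    exact Measure.map_id
  have h₂ : (Y.μ.map fun y => (y, F y)).map Prod.snd = Y.μ.map F := by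
    rw [Measure.map_map measurable_snd hgm]
    rfl
  have hdist : ∀ x ∈ K, ∀ y, |dist x y - dist (F x) (F y)| ≤ δ := by
    intro x hx y
    have h1 : dist (F x) (F y) ≤ dist x y := by simpa using hF.dist_le_mul x y
    obtain ⟨a, hat, hxa⟩ := mem_iUnion₂.1 (htK hx)
    have h2 := dist_le_pi_dist (F x) (F y) ⟨a, hat⟩
    rw [Real.dist_eq] at h2
    have h3 := (abs_le.1 h2).1
    have h4 := dist_triangle_right x y a
    rw [mem_ball] at hxa
    simp only [F] at h3
    rw [abs_of_nonneg (by linarith)]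
    linarith
  have hmass : ENNReal.ofReal (1 - δ) ≤
      (Y.μ.map fun y => (y, F y)) {p : Y × (t → ℝ) | p.1 ∈ K ∧ p.2 = F p.1} := by
    rw [Measure.map_apply hgm hclosed, ENNReal.ofReal_sub _ hδ.le, ENNReal.ofReal_one,
      tsub_le_iff_right]
    rw [measure_univ] at hK
    refine hK.le.trans ?_
    gcongr
    exact fun y hy => ⟨hy, rfl⟩
  refine box_le_of_coupling (X := Y) (Y := Y.lipschitzImage F hF) h₁ h₂ hδ.le hclosed ?_ hmass
  rintro ⟨x, x'⟩ ⟨hx, hx'⟩ ⟨y, y'⟩ ⟨-, hy'⟩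
  obtain rfl : x' = F x := hx'
  obtain rfl : y' = F y := hy'
  exact hdist x hx y

end MMSpace

/-! ### Closed downward sets and the corollary -/

namespace MMClass

/-- A `□`-closed set that is downwards closed for the Lipschitz order contains every class that is
approximately dominated by its elements. -/
theorem mem_of_forall_domApprox {Q : Set MMClass.{u}} (hc : IsBoxClosed Q)
    (hl : ∀ x ∈ Q, ∀ y : MMClass.{u}, Dom y x → y ∈ Q) {y : MMClass.{u}}
    (h : ∀ ε : ℝ, 0 < ε → ∃ x ∈ Q, DomApprox ε y x) : y ∈ Q := by
  obtain ⟨Y, rfl⟩ : ∃ Y, mk Y = y := Quotient.exists_rep y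
  have hreal : ∀ ε : ℝ≥0∞, 0 < ε → ∃ δ : ℝ, 0 < δ ∧ ENNReal.ofReal δ < ε := fun ε hε => by
    obtain ⟨δ, hδ, hδε⟩ := ENNReal.lt_iff_exists_nnreal_btwn.1 hε
    exact ⟨δ, by exact_mod_cast hδ, by simpa using hδε⟩
  have himage : ∀ (ι : Type u) [Fintype ι] (F : Y → ι → ℝ) (hF : LipschitzWith 1 F),
      mk (Y.lipschitzImage F hF) ∈ Q := by
    intro ι _ F hF
    refine hc _ fun ε hε => ?_
    obtain ⟨δ, hδ, hδε⟩ := hreal ε hε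
    have : IsProbabilityMeasure (Y.μ.map F) := (Y.lipschitzImage F hF).prob
    obtain ⟨η, hη, hbox⟩ := MMSpace.exists_box_le_of_le_thickening (Y.μ.map F) hδ
    -- The `η / 4` absorbs the factor `4` in the Prohorov estimate; the `1 / 2` keeps the error
    -- below `1`, so that the non-exceptional domain is non-empty.
    have hη' : 0 < min (η / 4) (1 / 2) := by positivity
    obtain ⟨x, hxQ, Y', X, hY', rfl, hYX⟩ := h _ hη'
    -- The approximate domination concerns another representative `Y'`, so `F` is moved there with
    -- the same law.
    obtain ⟨F', hF', hFF'⟩ :=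
      MMSpace.Iso.exists_lipschitz_map_eq (Quotient.exact hY'.symm : MMSpace.Iso Y Y') hF
    obtain ⟨G, hG, hGB⟩ := hYX.exists_lipschitz_le_thickening hη'
      ((min_le_right _ _).trans_lt (by norm_num)) hF'
    refine ⟨mk (X.lipschitzImage G hG), hl _ hxQ _ ⟨_, _, rfl, rfl, X.lipschitzImage_dom G hG⟩,
      ?_⟩
    have : IsProbabilityMeasure (X.μ.map G) := (X.lipschitzImage G hG).prob
    refine lt_of_le_of_lt (hbox (X.μ.map G) fun B hB => ?_) hδε
    have hle : 4 * min (η / 4) (1 / 2) ≤ η := by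
      linarith [min_le_left (η / 4) (1 / 2)]
    rw [← hFF']
    exact (hGB B hB).trans (add_le_add (measure_mono (thickening_mono hle _))
      (ENNReal.ofReal_le_ofReal hle))
  refine hc _ fun ε hε => ?_
  obtain ⟨δ, hδ, hδε⟩ := hreal ε hε
  obtain ⟨ι, _, F, hF, hbox⟩ := Y.exists_box_lipschitzImage_le hδ
  exact ⟨_, himage ι F hF, hbox.trans_lt hδε⟩

end MMClass

theorem mainTheorem6 (P Q : Set MMClass.{u})
    (hP : MMClass.IsPyramid P) (hQ : MMClass.IsPyramid Q)
    (hPQ : ∀ ε : ℝ, 0 < ε → MMClass.PyramidApprox ε P Q)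
    (hQP : ∀ ε : ℝ, 0 < ε → MMClass.PyramidApprox ε Q P) :
    P = Q :=
  Subset.antisymm
    (fun _ hy => MMClass.mem_of_forall_domApprox hQ.closed hQ.lower fun ε hε => hPQ ε hε _ hy)
    (fun _ hy => MMClass.mem_of_forall_domApprox hP.closed hP.lower fun ε hε => hQP ε hε _ hy)
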